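/- Let $2^\omega$ be Cantor space, the set of infinite binary sequences, and write $A\upharpoonright k$ for the string of the first $k$ bits of $A\in 2^\omega$. Let $\Sigma^0_n$ and $\Pi^0_n$ ($n\ge 1$) denote the levels of the (lightface) arithmetical hierarchy of subsets of $2^\omega$: on the spaces $\mathbb N^k\times 2^\omega$, the $\Sigma^0_1$ relations are those of the form $\exists m\,W(x,A\upharpoonright m)$ with $W$ computably enumerable, the $\Pi^0_n$ relations are the complements of the $\Sigma^0_n$ relations, and the $\Sigma^0_{n+1}$ relations are those of the form $\exists y\in\mathbb N\;R(y,x,A)$ with $R$ a $\Pi^0_n$ relation. For a class $\mathcal P$ of predicates (of any number of natural-number arguments and one finite binary string argument) and $n\ge 1$, let $\Sigma^0_n[\mathcal P]$ be the collection of all $\mathcal X\subseteq 2^\omega$ for which there is $P\in\mathcal P$ such that for all $A\in 2^\omega$ $$A\in\mathcal X\iff(\exists k_n)(\forall k_{n-1})\cdots(Qk_1)\;P(k_n,\ldots,k_2,A\upharpoonright k_1),$$ where the $n$ quantifiers over natural numbers alternate, so that $Q=\exists$ for odd $n$ and $Q=\forall$ for even $n$. Let $\Pi^0_n[\mathcal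 P]$ be defined in the same way with $n$ alternating quantifiers $(\forall k_n)(\exists k_{n-1})\cdots(Qk_1)$ starting with $\forall$. Inside the brackets, $\Sigma^0_1$ is the class of computably enumerable predicates and $\Pi^0_1$ is the class of predicates whose complement is computably enumerable. Then for every $n\ge 1$: 1. If $n$ is odd, then $$\Sigma^0_n\subsetneq\Sigma^0_n[\Pi^0_1]\subsetneq\Sigma^0_{n+1}\quad\text{and}\quad\Pi^0_n\subsetneq\Pi^0_n[\Sigma^0_1]\subsetneq\Pi^0_{n+1}.$$ 2. If $n$ is even, then $$\Sigma^0_n\subsetneq\Sigma^0_n[\Sigma^0_1]\subsetneq\Sigma^0_{n+1}\quad\text{and}\quad\Pi^0_n\subsetneq\Pi^0_n[\Pi^0_1]\subsetneq\Pi^0_{n+1}.$$ -/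

import Mathlib

namespace BorelHierarchy

/-- Cantor space: infinite binary sequences. -/
abbrev Cantor : Type := ℕ → Bool

/-- The initial segment `A↾m`, the finite string of the first `m` bits of `A`. -/
def initSeg (A : Cantor) (m : ℕ) : List Bool := (List.range m).map A

/-- The lightface class `Σ⁰ₙ` for relations on the product spaces `ℕᵏ × Cantor`.
`Σ⁰₁` is semirecursive (effectively open): the union of a computably enumerable family of
basic open sets. `Σ⁰ₙ₊₁` is existential number quantification over `Π⁰ₙ`, where `Π⁰ₙ`
consists of the complements of `Σ⁰ₙ` relations. (Level `0` is not used and is empty.) -/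
def IsSigma : ℕ → {k : ℕ} → ((Fin k → ℕ) → Cantor → Prop) → Prop
  | 0, _, _ => False
  | 1, k, R => ∃ W : (Fin k → ℕ) × List Bool → Prop,
      REPred W ∧ ∀ x A, R x A ↔ ∃ m : ℕ, W (x, initSeg A m)
  | n + 2, k, R => ∃ S : (Fin (k + 1) → ℕ) → Cantor → Prop,
      IsSigma (n + 1) S ∧ ∀ x A, R x A ↔ ∃ y : ℕ, ¬ S (Fin.cons y x) A

/-- The level `Σ⁰ₙ` of the arithmetical hierarchy of subsets of Cantor space. -/
def Sigma0 (n : ℕ) : Set (Set Cantor) :=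
  {X | IsSigma n (fun (_ : Fin 0 → ℕ) (A : Cantor) => A ∈ X)}

/-- The level `Π⁰ₙ` of the arithmetical hierarchy: complements of the `Σ⁰ₙ` classes. -/
def Pi0 (n : ℕ) : Set (Set Cantor) :=
  {X | Xᶜ ∈ Sigma0 n}

/-- A class of predicates `P(k₁, …, kⱼ, w)` with `j` number arguments (`j` arbitrary) and one
argument `w` that is a finite binary string. -/
abbrev PredClass : Type := (j : ℕ) → Set ((Fin j → ℕ) × List Bool → Prop)

/-- The computably enumerable predicates, `Σ⁰₁`. -/
def ceClass : PredClass := fun _ => {P | REPred P}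

/-- The co-c.e. predicates, `Π⁰₁`. -/
def coceClass : PredClass := fun _ => {P | REPred fun p => ¬ P p}

/-- Alternating prefix of `m` number quantifiers, outermost first:
`altQuant true m R` is `∃ v₀, ∀ v₁, ∃ v₂, … R (v₀, …, vₘ₋₁)`, and
`altQuant false m R` is `∀ v₀, ∃ v₁, ∀ v₂, … R (v₀, …, vₘ₋₁)`. -/
def altQuant : Bool → (m : ℕ) → ((Fin m → ℕ) → Prop) → Prop
  | _, 0, R => R Fin.elim0
  | true, m + 1, R => ∃ y : ℕ, altQuant false m fun v => R (Fin.cons y v)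
  | false, m + 1, R => ∀ y : ℕ, altQuant true m fun v => R (Fin.cons y v)

/-- The classes `Σ⁰ₙ[𝓟]` (for `b = true`) and `Π⁰ₙ[𝓟]` (for `b = false`), `n ≥ 1`: with
`n = j + 1` and `(v₀, …, vⱼ) = (kₙ, …, k₁)`, all `X` such that, for some `P` in `𝓟`, `A ∈ X`
iff `P(kₙ, …, k₂, A↾k₁)` holds under `n` alternating quantifiers over `kₙ, …, k₁`, starting
with `∃ kₙ`, respectively with `∀ kₙ`. (Level `0` is not used and is empty.) -/
def genLevel (b : Bool) (𝓟 : PredClass) : ℕ → Set (Set Cantor)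
  | 0 => ∅
  | j + 1 => {X | ∃ P ∈ 𝓟 j, ∀ A : Cantor, A ∈ X ↔
      altQuant b (j + 1) fun v => P (Fin.init v, initSeg A (v (Fin.last j)))}

/-- The class `Σ⁰ₙ[𝓟]`. -/
def genSigma (n : ℕ) (𝓟 : PredClass) : Set (Set Cantor) := genLevel true 𝓟 n

/-- The class `Π⁰ₙ[𝓟]`. -/
def genPi (n : ℕ) (𝓟 : PredClass) : Set (Set Cantor) := genLevel false 𝓟 n

end BorelHierarchy

/-!
The proof compares every class with *chains* `∃ v₀, ¬ ∃ v₁, ¬ ⋯ ∃ vⱼ₋₁, ¬ R`, the quantifier prefix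
by which the definition of `IsSigma` climbs `j` levels. With `n = j + 1`, pushing the negations of
an alternating prefix inwards (`altQuant_true_iff_chain`) turns `Σ⁰ₙ[Π⁰₁]` for odd `n` and
`Σ⁰ₙ[Σ⁰₁]` for even `n` into one and the same class `midSigma j`: the chains of length `j` above
`∃ y, ¬ W (v, A↾y)` with `W` c.e. (`genSigma_coceClass`, `genSigma_ceClass`). So it suffices to
show `Σ⁰ₙ ⊊ midSigma j ⊊ Σ⁰ₙ₊₁`; the statements about `Π` follow by taking complements.

* `Σ⁰ₙ ⊆ midSigma j`: a `Σ⁰ₙ` set is a chain above `∃ y, W (v, A↾y)` with `W` c.e., and `W` can be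
  made decidable by letting longer strings wait for the enumeration of `W`
  (`exists_computable_initSeg`).
* `midSigma j ⊆ Σ⁰ₙ₊₁`: the relation `∃ y, ¬ W (v, A↾y)` is `Σ⁰₂` (`midSigma_subset_Sigma0`).
* `midSigma j ≠ Σ⁰ₙ₊₁`: the set of those `A` that, read as the characteristic function of a matrix,
  define a boldface `Σ⁰ₙ` set not containing `A` is lightface `Π⁰ₙ`, hence `Σ⁰ₙ₊₁`, but not even
  boldface `Σ⁰ₙ` (`antiDiag_ne_chainSet`, `antiDiag_mem_Sigma0`).
* `Σ⁰ₙ ≠ midSigma j`: on the points `0ᵉ10^ω`, the extra quantifier hidden in the co-c.e. matrix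
  makes `midSigma j` as expressive as the `Σ⁰ₙ₊₁` sets of numbers `e`. These include the `Π⁰ₙ` set
  of those `e` for which `0ᵉ10^ω` is not in the `e`-th `Σ⁰ₙ` set, so some member of `midSigma j`
  differs from the `e`-th `Σ⁰ₙ` set at `0ᵉ10^ω` for every `e`
  (`chainSet_diagMatrix_notMem_Sigma0`).
-/

namespace BorelHierarchy

open Encodable Denumerable Nat.Partrec

/-! ### Computably enumerable predicates -/

section Computability

variable {α β : Type*} [Primcodable α] [Primcodable β]

/-- A c.e. predicate is enumerated in stages by a total computable test. -/
theorem exists_stage_of_rePred {p : α → Prop} (hp : REPred p) :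
    ∃ s : α → ℕ → Bool, Computable₂ s ∧ ∀ a, p a ↔ ∃ k, s a k = true := by
  obtain ⟨c, hc⟩ := Code.exists_code.1 hp
  refine ⟨fun a k => (Code.evaln k c (encode a)).isSome, ?_, fun a => ?_⟩
  · exact (Primrec.option_isSome.comp (Code.primrec_evaln.comp
      ((Primrec.snd.pair (Primrec.const c)).pair (Primrec.encode.comp Primrec.fst)))).to_comp
  · have h : p a ↔ (c.eval (encode a)).Dom := by
      rw [hc]
      simp [Part.assert]
    rw [h, Part.dom_iff_mem]
    simp only [Code.evaln_complete, Option.isSome_iff_exists, Option.mem_def]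
    exact exists_comm

theorem rePred_of_stage {p : α → Prop} {s : α → ℕ → Bool} (hs : Computable₂ s)
    (h : ∀ a, p a ↔ ∃ k, s a k = true) : REPred p := by
  refine (Partrec.rfind hs.partrec₂).dom_re.of_eq fun a => ?_
  rw [h, Nat.rfind_dom]
  simp

theorem rePred_comp {p : β → Prop} (hp : REPred p) {f : α → β} (hf : Computable f) :
    REPred fun a => p (f a) :=
  Partrec.comp hp hf

theorem rePred_of_computable {f : α → Bool} (hf : Computable f) : REPred fun a => f a = true :=
  rePred_of_stage (s := fun a _ => f a) (hf.comp Computable.fst) fun a => by simp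

theorem rePred_and {p q : α → Prop} (hp : REPred p) (hq : REPred q) :
    REPred fun a => p a ∧ q a := by
  obtain ⟨s, hs, hps⟩ := exists_stage_of_rePred hp
  obtain ⟨t, ht, hqt⟩ := exists_stage_of_rePred hq
  refine rePred_of_stage (s := fun a k => s a k.unpair.1 && t a k.unpair.2) ?_ fun a => ?_
  · have hu : Computable fun x : α × ℕ => x.2.unpair := Computable.unpair.comp Computable.snd
    exact Primrec.and.to_comp.comp
      (hs.comp Computable.fst (Computable.fst.comp hu))
      (ht.comp Computable.fst (Computable.snd.comp hu))
  · rw [hps, hqt]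
    constructor
    · rintro ⟨⟨k, hk⟩, l, hl⟩
      exact ⟨Nat.pair k l, by simp [hk, hl]⟩
    · rintro ⟨k, hk⟩
      rw [Bool.and_eq_true] at hk
      exact ⟨⟨_, hk.1⟩, _, hk.2⟩

theorem rePred_or {p q : α → Prop} (hp : REPred p) (hq : REPred q) :
    REPred fun a => p a ∨ q a := by
  obtain ⟨s, hs, hps⟩ := exists_stage_of_rePred hp
  obtain ⟨t, ht, hqt⟩ := exists_stage_of_rePred hq
  refine rePred_of_stage (s := fun a k => s a k || t a k) ?_ fun a => ?_
  · exact Primrec.or.to_comp.comp hs ht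
  · simp [hps, hqt, exists_or]

theorem rePred_exists_nat {p : α → ℕ → Prop} (hp : REPred fun x : α × ℕ => p x.1 x.2) :
    REPred fun a => ∃ y, p a y := by
  obtain ⟨s, hs, hps⟩ := exists_stage_of_rePred hp
  refine rePred_of_stage (s := fun a k => s (a, k.unpair.1) k.unpair.2) ?_ fun a => ?_
  · have hu : Computable fun x : α × ℕ => x.2.unpair := Computable.unpair.comp Computable.snd
    exact hs.comp (Computable.fst.pair (Computable.fst.comp hu)) (Computable.snd.comp hu)
  · constructor
    · rintro ⟨y, hy⟩
      obtain ⟨k, hk⟩ := (hps (a, y)).1 hy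
      exact ⟨Nat.pair y k, by simpa using hk⟩
    · rintro ⟨k, hk⟩
      exact ⟨_, (hps (a, k.unpair.1)).2 ⟨_, hk⟩⟩

theorem computable_pi {n : ℕ} {f : α → Fin n → ℕ} (h : ∀ i, Computable fun a => f a i) :
    Computable f := by
  have h1 : Computable fun a => List.Vector.ofFn fun i => f a i := Computable.vector_ofFn h
  have h2 : Computable fun v : List.Vector ℕ n => v.get := Primrec.vector_get'.to_comp
  refine (h2.comp h1).of_eq fun a => ?_
  ext i
  simp

theorem computable_apply {n : ℕ} (i : Fin n) : Computable fun v : Fin n → ℕ => v i :=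
  Computable.fin_app.comp Computable.id (Computable.const i)

theorem computable_tail {n : ℕ} : Computable fun v : Fin (n + 1) → ℕ => (Fin.tail v : Fin n → ℕ) :=
  computable_pi fun i => computable_apply i.succ

theorem computable_cons {n : ℕ} :
    Computable fun p : ℕ × (Fin n → ℕ) => (Fin.cons p.1 p.2 : Fin (n + 1) → ℕ) := by
  refine computable_pi fun i => ?_
  refine Fin.cases ?_ (fun i => ?_) i
  · simpa using Computable.fst
  · simpa using (computable_apply i).comp Computable.snd

theorem computable_snoc {n : ℕ} :
    Computable fun p : (Fin n → ℕ) × ℕ => (Fin.snoc p.1 p.2 : Fin (n + 1) → ℕ) := by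
  refine computable_pi fun i => ?_
  refine Fin.lastCases ?_ (fun i => ?_) i
  · simpa using Computable.snd
  · simpa using (computable_apply i).comp Computable.fst

end Computability

/-- The Gödel number of a tuple of numbers and a string. -/
def godelNumber {j : ℕ} (p : (Fin j → ℕ) × List Bool) : ℕ :=
  -- Instance search would find an encoding of tuples not known to be primitive recursive.
  @encode _ Primcodable.toEncodable p

theorem computable_godelNumber {j : ℕ} :
    Computable (godelNumber : (Fin j → ℕ) × List Bool → ℕ) :=
  Computable.encode

theorem godelNumber_injective {j : ℕ} :
    Function.Injective (godelNumber : (Fin j → ℕ) × List Bool → ℕ) :=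
  @encode_injective _ Primcodable.toEncodable

/-! ### Initial segments -/

@[simp] theorem length_initSeg (A : Cantor) (m : ℕ) : (initSeg A m).length = m := by
  simp [initSeg]

theorem take_initSeg (A : Cantor) {m l : ℕ} (h : m ≤ l) :
    (initSeg A l).take m = initSeg A m := by
  rw [initSeg, ← List.map_take, List.take_range, min_eq_left h, initSeg]

theorem getElem?_initSeg (A : Cantor) (m i : ℕ) :
    (initSeg A m)[i]? = if i < m then some (A i) else none := by
  by_cases h : i < m <;> simp [initSeg, h]

/-- A c.e. condition on some initial segment can be replaced by a decidable one: the length of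
the initial segment codes both the shorter string that is tested and a stage of the enumeration. -/
theorem exists_computable_initSeg {α : Type*} [Primcodable α] {W : α × List Bool → Prop}
    (hW : REPred W) : ∃ f : α × List Bool → Bool, Computable f ∧
      ∀ a A, (∃ m, W (a, initSeg A m)) ↔ ∃ m, f (a, initSeg A m) = true := by
  obtain ⟨s, hs, hWs⟩ := exists_stage_of_rePred hW
  refine ⟨fun x => s (x.1, x.2.take x.2.length.unpair.1) x.2.length.unpair.2, ?_, fun a A => ?_⟩
  · have hu : Computable fun x : α × List Bool => x.2.length.unpair :=
      Computable.unpair.comp (Computable.list_length.comp Computable.snd)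
    exact hs.comp (Computable.fst.pair
      (Primrec.list_take.to_comp.comp (Computable.fst.comp hu) Computable.snd))
      (Computable.snd.comp hu)
  · simp only [length_initSeg, take_initSeg A (Nat.unpair_left_le _)]
    constructor
    · rintro ⟨m, hm⟩
      obtain ⟨k, hk⟩ := (hWs _).1 hm
      exact ⟨Nat.pair m k, by simpa using hk⟩
    · rintro ⟨m, hm⟩
      exact ⟨_, (hWs _).2 ⟨_, hm⟩⟩

/-! ### Chains of negated existential quantifiers -/

/-- `chain j R` is `∃ v₀, ¬ ∃ v₁, ¬ ⋯ ∃ vⱼ₋₁, ¬ R (v₀, …, vⱼ₋₁)`: the prefix of `j` number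
quantifiers by which a `Σ⁰` level is reached from a level `j` steps below. -/
def chain : (j : ℕ) → ((Fin j → ℕ) → Prop) → Prop
  | 0, R => R Fin.elim0
  | j + 1, R => ∃ y : ℕ, ¬ chain j fun v => R (Fin.cons y v)

theorem chain_congr {j : ℕ} {R S : (Fin j → ℕ) → Prop} (h : ∀ v, R v ↔ S v) :
    chain j R ↔ chain j S := by
  rw [show R = S from funext fun v => propext (h v)]

theorem chain_succ_tail (j : ℕ) (R : (Fin j → ℕ) → Prop) :
    (chain (j + 1) fun v => R (Fin.tail v)) ↔ ¬ chain j R := by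
  simp [chain]

/-- The innermost quantifier of a chain can be peeled off as well as the outermost one. -/
theorem chain_succ_snoc (j : ℕ) (R : (Fin (j + 1) → ℕ) → Prop) :
    chain (j + 1) R ↔ chain j fun v => ∃ z, ¬ R (Fin.snoc v z : Fin (j + 1) → ℕ) := by
  induction j with
  | zero =>
    refine exists_congr fun y => not_congr (iff_of_eq (congrArg R ?_))
    ext i
    fin_cases i
    rfl
  | succ j ih =>
    refine exists_congr fun y => not_congr ((ih _).trans (chain_congr fun v => ?_))
    simp only [Fin.cons_snoc_eq_snoc_cons]

theorem altQuant_false (m : ℕ) (R : (Fin m → ℕ) → Prop) :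
    altQuant false m R ↔ ¬ altQuant true m fun v => ¬ R v := by
  have h : ∀ (m : ℕ) (R : (Fin m → ℕ) → Prop),
      (altQuant false m R ↔ ¬ altQuant true m fun v => ¬ R v) ∧
      (altQuant true m R ↔ ¬ altQuant false m fun v => ¬ R v) := by
    intro m
    induction m with
    | zero => intro R; simp [altQuant]
    | succ m ih =>
      intro R
      simp only [altQuant, not_exists, not_forall]
      refine ⟨forall_congr' fun y => ?_, exists_congr fun y => ?_⟩
      · exact (ih _).2
      · exact (ih _).1
  exact (h m R).1

/-- An alternating prefix of length `j + 1` is a chain of length `j` above one existential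
quantifier; the matrix is negated when `j` is odd. -/
theorem altQuant_true_iff_chain (j : ℕ) (P : (Fin j → ℕ) → ℕ → Prop) :
    (altQuant true (j + 1) fun v => P (Fin.init v) (v (Fin.last j))) ↔
      chain j fun v => ∃ y, (Even j ↔ P v y) := by
  induction j with
  | zero =>
    simp only [altQuant, chain, Even.zero, true_iff]
    refine exists_congr fun y => iff_of_eq (congrArg₂ P (Subsingleton.elim _ _) rfl)
  | succ j ih =>
    refine exists_congr fun y => ?_
    rw [altQuant_false]
    refine not_congr ?_
    have hinit : ∀ v : Fin (j + 1) → ℕ,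
        (Fin.init (Fin.cons y v : Fin (j + 2) → ℕ)) = Fin.cons y (Fin.init v) := by
      intro v
      ext i
      refine Fin.cases ?_ (fun i => ?_) i <;> simp [Fin.init]
    have hlast : ∀ v : Fin (j + 1) → ℕ,
        (Fin.cons y v : Fin (j + 2) → ℕ) (Fin.last (j + 1)) = v (Fin.last j) := by
      intro v
      rw [← Fin.succ_last, Fin.cons_succ]
    simp only [hinit, hlast]
    refine (ih fun v z => ¬ P (Fin.cons y v) z).trans (chain_congr fun v => ?_)
    refine exists_congr fun z => ?_
    rw [Nat.even_add_one]
    tauto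

/-! ### The arithmetical hierarchy in terms of chains -/

/-- Normal form: a `Σ⁰ⱼ₊₁` relation is a chain of length `j` above a `Σ⁰₁` relation. -/
theorem exists_chain_of_isSigma {j k : ℕ} {R : (Fin k → ℕ) → Cantor → Prop}
    (h : IsSigma (j + 1) R) :
    ∃ W : ((Fin j → ℕ) × (Fin k → ℕ)) × List Bool → Prop, REPred W ∧
      ∀ x A, R x A ↔ chain j fun v => ∃ m, W ((v, x), initSeg A m) := by
  induction j generalizing k with
  | zero =>
    obtain ⟨W, hW, h⟩ := h
    refine ⟨fun p => W (p.1.2, p.2), ?_, fun x A => h x A⟩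
    exact rePred_comp hW ((Computable.snd.comp Computable.fst).pair Computable.snd)
  | succ j ih =>
    obtain ⟨S, hS, h⟩ := h
    obtain ⟨W, hW, h'⟩ := ih hS
    refine ⟨fun p => W ((Fin.tail p.1.1, Fin.cons (p.1.1 0) p.1.2), p.2), ?_, fun x A => ?_⟩
    · have hv : Computable fun p : ((Fin (j + 1) → ℕ) × (Fin k → ℕ)) × List Bool => p.1.1 :=
        Computable.fst.comp Computable.fst
      exact rePred_comp hW (((computable_tail.comp hv).pair (computable_cons.comp
        (((computable_apply 0).comp hv).pair (Computable.snd.comp Computable.fst)))).pair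
          Computable.snd)
    · rw [h]
      refine exists_congr fun y => not_congr ((h' _ A).trans (chain_congr fun v => ?_))
      simp

/-- A chain of length `j` above a `Σ⁰ᵢ₊₁` matrix is `Σ⁰ᵢ₊ⱼ₊₁`. The matrix lives on a product
space that is not itself a power of `ℕ`, so its level is expressed through computable
substitutions. -/
theorem isSigma_chain (i : ℕ) {j k : ℕ}
    (R : (Fin j → ℕ) × (Fin k → ℕ) → Cantor → Prop)
    (h : ∀ (l : ℕ) (f : (Fin l → ℕ) → (Fin j → ℕ) × (Fin k → ℕ)), Computable f →
      IsSigma (i + 1) fun z A => R (f z) A) :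
    IsSigma (i + j + 1) fun x A => chain j fun v => R (v, x) A := by
  induction j generalizing k with
  | zero => exact h k (fun x => (Fin.elim0, x)) ((Computable.const _).pair Computable.id)
  | succ j ih =>
    refine ⟨_, ih (k := k + 1) (fun p A => R (Fin.cons (p.2 0) p.1, Fin.tail p.2) A) ?_,
      fun x A => ?_⟩
    · intro l f hf
      have h2 := Computable.snd.comp hf
      exact h l _ ((computable_cons.comp
        (((computable_apply 0).comp h2).pair (Computable.fst.comp hf))).pair
          (computable_tail.comp h2))
    · simp [chain]

/-- The set defined by a chain of length `j` above `∃ y, M (v, A↾y)`. -/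
def chainSet (j : ℕ) (M : (Fin j → ℕ) × List Bool → Prop) : Set Cantor :=
  {A | chain j fun v => ∃ y, M (v, initSeg A y)}

/-- The refined level between `Σ⁰ⱼ₊₁` and `Σ⁰ⱼ₊₂`: chains of length `j` above an existential
quantifier with a co-c.e. matrix. -/
def midSigma (j : ℕ) : Set (Set Cantor) :=
  {X | ∃ W, REPred W ∧ X = chainSet j fun p => ¬ W p}

theorem exists_chainSet_of_mem_Sigma0 {j : ℕ} {X : Set Cantor} (h : X ∈ Sigma0 (j + 1)) :
    ∃ f : (Fin j → ℕ) × List Bool → Bool, Computable f ∧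
      X = chainSet j fun p => f p = true := by
  obtain ⟨W, hW, h⟩ := exists_chain_of_isSigma h
  have hW' : REPred fun p : (Fin j → ℕ) × List Bool => W ((p.1, Fin.elim0), p.2) :=
    rePred_comp hW ((Computable.fst.pair (Computable.const _)).pair Computable.snd)
  obtain ⟨f, hf, hfW⟩ := exists_computable_initSeg hW'
  refine ⟨f, hf, Set.ext fun A => (h Fin.elim0 A).trans (chain_congr fun v => hfW v A)⟩

theorem Sigma0_subset_midSigma (j : ℕ) : Sigma0 (j + 1) ⊆ midSigma j := by
  intro X hX
  obtain ⟨f, hf, rfl⟩ := exists_chainSet_of_mem_Sigma0 hX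
  refine ⟨fun p => (!f p) = true, rePred_of_computable (Primrec.not.to_comp.comp hf), ?_⟩
  simp

theorem midSigma_subset_Sigma0 (j : ℕ) : midSigma j ⊆ Sigma0 (j + 2) := by
  rintro _ ⟨W, hW, rfl⟩
  have := isSigma_chain 1 (j := j) (k := 0) (fun p A => ∃ y, ¬ W (p.1, initSeg A y)) ?_
  · rwa [Nat.add_comm 1 j] at this
  intro l f hf
  refine ⟨fun z A => W ((f (Fin.tail z)).1, initSeg A (z 0)), ?_, fun x A => by simp⟩
  refine ⟨fun p => decide (p.2.length = p.1 0) = true ∧ W ((f (Fin.tail p.1)).1, p.2), ?_,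
    fun x A => by simp⟩
  refine rePred_and (rePred_of_computable ?_) (rePred_comp hW ?_)
  · exact (Primrec.eq (α := ℕ)).decide.to_comp.comp (Computable.list_length.comp Computable.snd)
      ((computable_apply 0).comp Computable.fst)
  · exact (Computable.fst.comp (hf.comp (computable_tail.comp Computable.fst))).pair
      Computable.snd

/-! ### Strictness of the upper inclusion -/

/-- The set of those `A` that do not belong to the boldface set `chainSet j M` whose matrix `M`
has characteristic function `A`. -/
def antiDiag (j : ℕ) : Set Cantor :=
  {A | ¬ chain j fun v => ∃ y, A (godelNumber (v, initSeg A y)) = true}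

theorem antiDiag_ne_chainSet (j : ℕ) (M : (Fin j → ℕ) × List Bool → Prop) :
    antiDiag j ≠ chainSet j M := by
  classical
  intro h
  let A : Cantor := fun n => decide (∃ p, godelNumber p = n ∧ M p)
  have hA : A ∈ antiDiag j ↔ A ∉ chainSet j M := by
    refine not_congr (chain_congr fun v => exists_congr fun y => ?_)
    simp [A, godelNumber_injective.eq_iff]
  rw [h] at hA
  exact iff_not_self hA

/-- Querying the oracle `A` at the code of one of its own initial segments is semirecursive. -/
theorem isSigma_one_exists_godelNumber {j l : ℕ} {g : (Fin l → ℕ) → (Fin j → ℕ)}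
    (hg : Computable g) :
    IsSigma 1 fun z A => ∃ y, A (godelNumber (g z, initSeg A y)) = true := by
  -- The length of the string codes the `y` to be tested, with room to make the string long
  -- enough for its bit at the code of `(g z, A↾y)` to be defined.
  let t : (Fin l → ℕ) × List Bool → Bool := fun p =>
    p.2.getD (godelNumber (g p.1, p.2.take p.2.length.unpair.1)) false
  have ht : Computable t := by
    have hs : Computable fun p : (Fin l → ℕ) × List Bool => p.2.take p.2.length.unpair.1 :=
      Primrec.list_take.to_comp.comp (Computable.fst.comp (Computable.unpair.comp
        (Computable.list_length.comp Computable.snd))) Computable.snd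
    exact (Primrec.list_getD false).to_comp.comp Computable.snd
      (computable_godelNumber.comp ((hg.comp Computable.fst).pair hs))
  refine ⟨fun p => t p = true, rePred_of_computable ht, fun z A => ?_⟩
  simp only [t, length_initSeg, take_initSeg A (Nat.unpair_left_le _), List.getD_eq_getElem?_getD,
    getElem?_initSeg]
  constructor
  · rintro ⟨y, hy⟩
    refine ⟨Nat.pair y (godelNumber (g z, initSeg A y) + 1), ?_⟩
    have hlt := Nat.right_le_pair y (godelNumber (g z, initSeg A y) + 1)
    simp only [Nat.unpair_pair]
    rw [if_pos (Nat.lt_of_succ_le hlt), hy, Option.getD_some]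
  · rintro ⟨m, hm⟩
    refine ⟨m.unpair.1, ?_⟩
    split_ifs at hm
    · exact hm
    · cases hm

theorem antiDiag_mem_Sigma0 (j : ℕ) : antiDiag j ∈ Sigma0 (j + 2) := by
  -- A dummy outermost quantifier turns the negation of a chain into a longer chain.
  have h := isSigma_chain 0 (j := j + 1) (k := 0)
    (fun p A => ∃ y, A (godelNumber (Fin.tail p.1, initSeg A y)) = true)
    fun l f hf => isSigma_one_exists_godelNumber
      (computable_tail.comp (Computable.fst.comp hf))
  rw [Nat.zero_add] at h
  refine (?_ : IsSigma (j + 2) fun (_ : Fin 0 → ℕ) (A : Cantor) => A ∈ antiDiag j)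
  convert h using 3 with _ A
  exact (chain_succ_tail j fun v => ∃ y, A (godelNumber (v, initSeg A y)) = true).symm

theorem midSigma_ssubset_Sigma0 (j : ℕ) : midSigma j ⊂ Sigma0 (j + 2) := by
  refine (Set.ssubset_iff_of_subset (midSigma_subset_Sigma0 j)).2
    ⟨antiDiag j, antiDiag_mem_Sigma0 j, ?_⟩
  rintro ⟨W, -, hW⟩
  exact antiDiag_ne_chainSet j _ hW

/-! ### Strictness of the lower inclusion -/

/-- The computable sequence `0ᵉ10^ω`. -/
def point (e : ℕ) : Cantor := fun i => i == e

theorem idxOf_initSeg_point (e m : ℕ) :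
    (initSeg (point e) m).idxOf true = min e m := by
  induction m with
  | zero => simp [initSeg]
  | succ m ih =>
    have hs : initSeg (point e) (m + 1) = initSeg (point e) m ++ [point e m] := by
      simp [initSeg, List.range_succ]
    have hmem : true ∈ initSeg (point e) m ↔ e < m := by
      simp [initSeg, point]
    rw [hs]
    by_cases h : e < m
    · rw [List.idxOf_append_of_mem (hmem.2 h), ih]
      omega
    · rw [List.idxOf_append_of_notMem (mt hmem.1 h), length_initSeg]
      by_cases he : m = e
      · subst he; simp [point]
      · have : (m == e) = false := by simpa using he
        simp [point, this]
        omega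

theorem computable_initSeg_point : Computable₂ fun e m => initSeg (point e) m := by
  refine Primrec.to_comp ?_
  exact Primrec.list_map (Primrec.list_range.comp Primrec.snd)
    (Primrec.beq.comp Primrec.snd (Primrec.fst.comp Primrec.fst))

/-- The `e`-th c.e. predicate holds of `(v, 0ᵉ10^ω↾y)` for some `y`. -/
def evalAtPoint (j : ℕ) (e : ℕ) (v : Fin j → ℕ) : Prop :=
  ∃ y, ((ofNat Code e).eval (godelNumber (v, initSeg (point e) y))).Dom

theorem rePred_evalAtPoint (j : ℕ) :
    REPred fun p : ℕ × (Fin j → ℕ) => evalAtPoint j p.1 p.2 := by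
  refine rePred_exists_nat (p := fun (p : ℕ × (Fin j → ℕ)) y =>
    ((ofNat Code p.1).eval (godelNumber (p.2, initSeg (point p.1) y))).Dom) ?_
  have h1 : Computable fun x : (ℕ × (Fin j → ℕ)) × ℕ => x.1.1 :=
    Computable.fst.comp Computable.fst
  exact (Code.eval_part.comp ((Computable.ofNat Code).comp h1) (computable_godelNumber.comp
    ((Computable.snd.comp Computable.fst).pair
      (computable_initSeg_point.comp h1 Computable.snd)))).dom_re

/-- The c.e. predicate whose negation is the matrix of the diagonal set. A string `0ᵉ1τ` supplies
the index `e`, and the length of `τ` supplies the innermost quantified number; no string `0ᵐ` is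
in the negation, so that such strings do not influence an existential quantifier. -/
def diagMatrix (j : ℕ) (p : (Fin j → ℕ) × List Bool) : Prop :=
  decide (p.2.length ≤ p.2.idxOf true) = true ∨
    evalAtPoint j (p.2.idxOf true)
      (Fin.tail (Fin.snoc p.1 (p.2.length - p.2.idxOf true - 1) : Fin (j + 1) → ℕ))

theorem rePred_diagMatrix (j : ℕ) : REPred (diagMatrix j) := by
  have hi : Computable fun p : (Fin j → ℕ) × List Bool => p.2.idxOf true :=
    Primrec.list_idxOf.to_comp.comp (Computable.const true) Computable.snd
  have hl : Computable fun p : (Fin j → ℕ) × List Bool => p.2.length :=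
    Computable.list_length.comp Computable.snd
  refine rePred_or (rePred_of_computable ?_) (rePred_comp (rePred_evalAtPoint j) (hi.pair ?_))
  · exact Primrec.nat_le.decide.to_comp.comp hl hi
  · exact computable_tail.comp (computable_snoc.comp (Computable.fst.pair
      (Primrec.nat_sub.to_comp.comp (Primrec.nat_sub.to_comp.comp hl hi) (Computable.const 1))))

theorem point_mem_chainSet_diagMatrix (j e : ℕ) :
    point e ∈ chainSet j (fun p => ¬ diagMatrix j p) ↔ ¬ chain j (evalAtPoint j e) := by
  rw [← chain_succ_tail, chain_succ_snoc]
  refine chain_congr fun v => ?_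
  simp only [diagMatrix, length_initSeg, idxOf_initSeg_point, decide_eq_true_eq, not_or, not_le]
  constructor
  · rintro ⟨y, hy, h⟩
    rw [min_eq_left (by omega)] at h
    exact ⟨_, h⟩
  · rintro ⟨z, h⟩
    refine ⟨e + z + 1, by omega, ?_⟩
    rwa [min_eq_left (by omega), show e + z + 1 - e - 1 = z by omega]

theorem chainSet_diagMatrix_notMem_Sigma0 (j : ℕ) :
    chainSet j (fun p => ¬ diagMatrix j p) ∉ Sigma0 (j + 1) := by
  intro h
  obtain ⟨f, hf, hX⟩ := exists_chainSet_of_mem_Sigma0 h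
  obtain ⟨c, hc⟩ := Code.exists_code.1 (rePred_of_computable hf)
  have key : point (encode c) ∈ chainSet j (fun p => f p = true) ↔
      chain j (evalAtPoint j (encode c)) := by
    refine chain_congr fun v => exists_congr fun y => ?_
    rw [ofNat_encode, hc]
    simp only [godelNumber, encodek]
    simp [Part.assert]
  rw [← hX, point_mem_chainSet_diagMatrix] at key
  exact not_iff_self key

theorem Sigma0_ssubset_midSigma (j : ℕ) : Sigma0 (j + 1) ⊂ midSigma j :=
  (Set.ssubset_iff_of_subset (Sigma0_subset_midSigma j)).2
    ⟨_, ⟨_, rePred_diagMatrix j, rfl⟩, chainSet_diagMatrix_notMem_Sigma0 j⟩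

/-! ### Identification of the refined levels and duality -/

theorem mem_genSigma_iff {j : ℕ} {𝓟 : PredClass} {X : Set Cantor} :
    X ∈ genSigma (j + 1) 𝓟 ↔ ∃ P ∈ 𝓟 j, X = chainSet j fun p => (Even j ↔ P p) := by
  refine exists_congr fun P => and_congr_right fun _ => ?_
  rw [Set.ext_iff]
  refine forall_congr' fun A => ?_
  rw [altQuant_true_iff_chain j fun v y => P (v, initSeg A y)]
  rfl

theorem genSigma_coceClass {j : ℕ} (hj : Even j) : genSigma (j + 1) coceClass = midSigma j := by
  ext X
  simp only [mem_genSigma_iff, hj, true_iff, midSigma, coceClass, Set.mem_ofPred_eq]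
  constructor
  · rintro ⟨P, hP, rfl⟩
    exact ⟨_, hP, by simp⟩
  · rintro ⟨W, hW, rfl⟩
    exact ⟨fun p => ¬ W p, by simpa using hW, rfl⟩

theorem genSigma_ceClass {j : ℕ} (hj : ¬ Even j) : genSigma (j + 1) ceClass = midSigma j := by
  ext X
  simp only [mem_genSigma_iff, hj, false_iff, midSigma, ceClass, Set.mem_ofPred_eq]

theorem mem_genPi_iff {n : ℕ} (hn : 1 ≤ n) {𝓟 𝓠 : PredClass}
    (h : ∀ j P, P ∈ 𝓟 j ↔ (fun p => ¬ P p) ∈ 𝓠 j) {X : Set Cantor} :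
    X ∈ genPi n 𝓟 ↔ Xᶜ ∈ genSigma n 𝓠 := by
  obtain ⟨j, rfl⟩ := Nat.exists_eq_add_of_le' hn
  have hq : ∀ P : (Fin j → ℕ) × List Bool → Prop,
      (∀ A, A ∈ X ↔ altQuant false (j + 1) fun v => P (Fin.init v, initSeg A (v (Fin.last j)))) ↔
      ∀ A, A ∈ Xᶜ ↔
        altQuant true (j + 1) fun v => ¬ P (Fin.init v, initSeg A (v (Fin.last j))) := by
    intro P
    refine forall_congr' fun A => ?_
    rw [altQuant_false, Set.mem_compl_iff]
    tauto
  constructor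
  · rintro ⟨P, hP, hX⟩
    exact ⟨_, (h j P).1 hP, (hq P).1 hX⟩
  · rintro ⟨Q, hQ, hX⟩
    refine ⟨fun p => ¬ Q p, (h j _).2 (by simpa using hQ), (hq fun p => ¬ Q p).2 (by simpa using hX)⟩

theorem genPi_ceClass {n : ℕ} (hn : 1 ≤ n) :
    genPi n ceClass = compl ⁻¹' genSigma n coceClass :=
  Set.ext fun _ => mem_genPi_iff hn fun _ _ => by simp [ceClass, coceClass]

theorem genPi_coceClass {n : ℕ} (hn : 1 ≤ n) :
    genPi n coceClass = compl ⁻¹' genSigma n ceClass :=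
  Set.ext fun _ => mem_genPi_iff hn fun _ _ => Iff.rfl

theorem compl_preimage_ssubset {α : Type*} {C D : Set (Set α)} (h : C ⊂ D) :
    compl ⁻¹' C ⊂ compl ⁻¹' D :=
  ⟨Set.preimage_mono h.1, fun h' =>
    h.2 ((Set.preimage_subset_preimage_iff (by simp [compl_surjective.range_eq])).1 h')⟩

end BorelHierarchy

theorem mainTheorem10 (n : ℕ) (hn : 1 ≤ n) :
    (Odd n →
      (BorelHierarchy.Sigma0 n ⊂ BorelHierarchy.genSigma n BorelHierarchy.coceClass ∧
        BorelHierarchy.genSigma n BorelHierarchy.coceClass ⊂ BorelHierarchy.Sigma0 (n + 1)) ∧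
      (BorelHierarchy.Pi0 n ⊂ BorelHierarchy.genPi n BorelHierarchy.ceClass ∧
        BorelHierarchy.genPi n BorelHierarchy.ceClass ⊂ BorelHierarchy.Pi0 (n + 1))) ∧
    (Even n →
      (BorelHierarchy.Sigma0 n ⊂ BorelHierarchy.genSigma n BorelHierarchy.ceClass ∧
        BorelHierarchy.genSigma n BorelHierarchy.ceClass ⊂ BorelHierarchy.Sigma0 (n + 1)) ∧
      (BorelHierarchy.Pi0 n ⊂ BorelHierarchy.genPi n BorelHierarchy.coceClass ∧
        BorelHierarchy.genPi n BorelHierarchy.coceClass ⊂ BorelHierarchy.Pi0 (n + 1))) := by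
  open BorelHierarchy in
  rw [genPi_ceClass hn, genPi_coceClass hn]
  obtain ⟨j, rfl⟩ := Nat.exists_eq_add_of_le' hn
  have lower := Sigma0_ssubset_midSigma j
  have upper := midSigma_ssubset_Sigma0 j
  have sandwich := And.intro (And.intro lower upper)
    (And.intro (compl_preimage_ssubset lower) (compl_preimage_ssubset upper))
  refine ⟨fun h => ?_, fun h => ?_⟩
  · rw [genSigma_coceClass (by grind)]
    exact sandwich
  · rw [genSigma_ceClass (by grind)]
    exact sandwich
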